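/- Let $p,q>0$ and let $u=(u_{n,m})_{n,m\in\mathbb Z}$ be a real solution of the lattice potential KdV equation (H1) $$(u_{n+1,m+1}-u_{n,m})(u_{n+1,m}-u_{n,m+1})=p^2-q^2 .$$ Suppose that $u$ has the linear background $pn+qm$, in the sense that for every $m$ the difference $u_{n,m}-pn-qm$ converges, as $n\to-\infty$ and as $n\to+\infty$, to constants $c_-$ and $c_+$ which do not depend on $m$. (The case $c_-=c_+=c$ is $u=pn+qm+c+w$ with $w\to0$ as $|n|\to\infty$.) Suppose also that $\sum_{n\in\mathbb Z}|u_{n+2,m}-u_{n,m}-2p|<\infty$ for every $m$, and that $$x_{n,m}=\frac{u_{n+1,m}-u_{n-1,m}}{2p}$$ is nonzero for all $n,m$. Define $\omega_j=\omega_j(n,m)$ by $$\omega_1(n,m)=1-\frac1{x_{n,m}x_{n-1,m}},\qquad \omega_{j+1}(n,m)=\omega_j(n-1,m)-\sum_{k=1}^{j}\omega_k(n-1,m)\,\omega_{j+1-k}(n,m)\quad(j\ge1),$$ and, for $j\ge1$, the polynomials $$h_j(t_1,t_2,\dots)=\sum_{\|\alpha\|=j}(-1)^{|\alpha|-1}(|\alpha|-1)!\,\frac{t^\alpha}{\alpha!},$$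 where the sum is over multi-indices $\alpha=(\alpha_1,\alpha_2,\dots)$ of non-negative integers, $|\alpha|=\sum_i\alpha_i$, $\|\alpha\|=\sum_i i\alpha_i$, $t^\alpha=\prod_i t_i^{\alpha_i}$ and $\alpha!=\prod_i\alpha_i!$. Put $F_0=\ln x$ (read as $\ln|x|$ wherever $x<0$) and $F_j=h_j(\omega_1,\omega_2,\dots)$ for $j\ge1$. Then: 1. For every $m$, the formal power series $\omega(n)=x_{n,m}\bigl(1+\sum_{j\ge1}\omega_j(n,m)\lambda^j\bigr)$, $n\in\mathbb Z$, form the unique family of formal power series in $\lambda$ with constant terms $x_{n,m}$ that satisfies the discrete Riccati equation $\omega(n)\,(\omega(n+1)-x_{n+1,m})-\lambda x_{n+1,m}\,\omega(n)+\lambda=0$ for all $n$. Moreover $\ln\bigl(1+\sum_{i\ge1}\omega_i\lambda^i\bigr)=\sum_{j\ge1}F_j\lambda^j$ as formal power series, for all $n,m$. 2. Every $F_j$, $j\ge0$, is a conserved density: for every $m$, $F_j(n,m)\to0$ as $|n|\to\infty$, and there is $J_j(n,m)$ with $F_j(n,m+1)-F_j(n,m)=J_j(n+1,m)-J_j(n,m)$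 for all $n,m$ and, for every $m$, $J_j(n,m)\to0$ as $|n|\to\infty$. 3. The series $H_0=\sum_{n\in\mathbb Z}\ln x_{n,m}$ and $H_j=\sum_{n\in\mathbb Z}h_j(\omega_1,\omega_2,\dots)$, $j\ge1$, converge absolutely for every $m$, and their values do not depend on $m$; so they are infinitely many conserved quantities. -/

import Mathlib

open Filter Topology PowerSeries

noncomputable section

namespace LpKdV

/-- The lattice potential KdV equation (H1) for `u n m = u_{n,m}`, with lattice parameters `p`
(direction `n`) and `q` (direction `m`). -/
def IsSolution (p q : ℝ) (u : ℤ → ℤ → ℝ) : Prop :=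
  ∀ n m : ℤ, (u (n + 1) (m + 1) - u n m) * (u (n + 1) m - u n (m + 1)) = p ^ 2 - q ^ 2

/-- The solution sits on the linear background `p n + q m + c`: for every `m`, the difference
`u_{n,m} - (p n + q m)` converges as `n → -∞` and as `n → +∞`, to constants that do not depend
on `m`. The case of one and the same constant `c` at both ends is `u = p n + q m + c + w` with
`w → 0` as `|n| → ∞`; for `N`-soliton solutions the two constants differ. -/
def HasLinearBackground (p q : ℝ) (u : ℤ → ℤ → ℝ) : Prop :=
  ∃ cLeft cRight : ℝ, ∀ m : ℤ,
    Tendsto (fun n : ℤ => u n m - (p * n + q * m)) atBot (𝓝 cLeft) ∧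
    Tendsto (fun n : ℤ => u n m - (p * n + q * m)) atTop (𝓝 cRight)

/-- `s_{n,m} = u_{n+2,m} - u_{n,m}`. -/
def potential (u : ℤ → ℤ → ℝ) (n m : ℤ) : ℝ := u (n + 2) m - u n m

/-- The space `P_μ` of potentials on a line: `∑_n |n ^ μ (s_n - 2 p)| < ∞`. -/
def MemP (p : ℝ) (μ : ℕ) (s : ℤ → ℝ) : Prop :=
  Summable fun n : ℤ => |(n : ℝ) ^ μ * (s n - 2 * p)|

/-- `x_{n,m} = (u_{n+1,m} - u_{n-1,m}) / (2 p)`. -/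
def xField (p : ℝ) (u : ℤ → ℤ → ℝ) (n m : ℤ) : ℝ := (u (n + 1) m - u (n - 1) m) / (2 * p)

/-- The coefficients `ω_j` at the site `n`, as functions of `x : ℤ → ℝ`:
`ω_0 = 1`, `ω_1(n) = 1 - 1 / (x_n x_{n-1})` and, for `j ≥ 1`,
`ω_{j+1}(n) = ω_j(n-1) - ∑_{k=1}^{j} ω_k(n-1) ω_{j+1-k}(n)`. -/
def omegaCoeff (x : ℤ → ℝ) : ℕ → ℤ → ℝ
  | 0, _ => 1
  | 1, n => 1 - 1 / (x n * x (n - 1))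
  | (j + 2), n => omegaCoeff x (j + 1) (n - 1) -
      ∑ k : Fin (j + 1), omegaCoeff x (k + 1) (n - 1) * omegaCoeff x (j + 1 - k) n

/-- The recursion gives the expected closed form of `ω_2`. -/
theorem omegaCoeff_two (x : ℤ → ℝ) (n : ℤ) :
    omegaCoeff x 2 n =
      (1 - 1 / (x (n - 1) * x (n - 1 - 1))) * (1 / (x n * x (n - 1))) := by
  simp [omegaCoeff]
  ring

/-- The formal power series `ω = x (1 + ∑_{j ≥ 1} ω_j λ ^ j)` at the site `n`; the variable `X` of
the power series is the spectral parameter `λ`. -/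
def omegaSeries (x : ℤ → ℝ) (n : ℤ) : ℝ⟦X⟧ :=
  PowerSeries.C (x n) * PowerSeries.mk fun j => omegaCoeff x j n

/-- The discrete Riccati equation
`ω_n (ω_{n+1} - x_{n+1}) - λ x_{n+1} ω_n + λ = 0` in formal power series in `λ`. -/
def IsRiccatiSolution (x : ℤ → ℝ) (ω : ℤ → ℝ⟦X⟧) : Prop :=
  ∀ n : ℤ, ω n * (ω (n + 1) - PowerSeries.C (x (n + 1)))
    - PowerSeries.X * PowerSeries.C (x (n + 1)) * ω n + PowerSeries.X = 0

/-- The `h`-polynomials (for `j ≥ 1`), evaluated at `t = (t_1, t_2, …)`: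
`h_j(t) = ∑_{‖α‖ = j} (-1) ^ (|α| - 1) (|α| - 1)! t ^ α / α!`, the sum over all multi-indices
`α = (α_1, α_2, …)` with `‖α‖ = ∑ i α_i = j`. Such an `α` is supported in `{1, …, j}` and has
`1 ≤ |α| ≤ j`; the sum is grouped by `k = |α| = ∑ α_i`. -/
def hPoly (j : ℕ) (t : ℕ → ℝ) : ℝ :=
  ∑ k ∈ Finset.Icc 1 j,
    ∑ α ∈ (Finset.piAntidiag (Finset.Icc 1 j) k).filter
        (fun α : ℕ → ℕ => ∑ i ∈ Finset.Icc 1 j, i * α i = j),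
      (-1 : ℝ) ^ (k - 1) * ((k - 1).factorial : ℝ) *
        ((∏ i ∈ Finset.Icc 1 j, t i ^ α i) / (∏ i ∈ Finset.Icc 1 j, ((α i).factorial : ℝ)))

/-- The densities `F_0 = ln x` and `F_j = h_j(ω)`, `j ≥ 1`. (`Real.log x` is `ln |x|`, which is
`ln x` when `x > 0`.) -/
def density (p : ℝ) (u : ℤ → ℤ → ℝ) (j : ℕ) (n m : ℤ) : ℝ :=
  if j = 0 then Real.log (xField p u n m)
  else hPoly j (fun i => omegaCoeff (fun k => xField p u k m) i n)

/-- `F` is a conserved density with respect to `m`: `F → 0` as `|n| → ∞`, and there is a flux `J`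
with `J → 0` as `|n| → ∞` and `(E_m - 1) F = (E_n - 1) J`. -/
def IsConservedDensity (F : ℤ → ℤ → ℝ) : Prop :=
  (∀ m : ℤ, Tendsto (fun n => F n m) cofinite (𝓝 0)) ∧
  ∃ J : ℤ → ℤ → ℝ,
    (∀ n m : ℤ, F n (m + 1) - F n m = J (n + 1) m - J n m) ∧
    ∀ m : ℤ, Tendsto (fun n => J n m) cofinite (𝓝 0)

end LpKdV

end

/-! The Riccati equation is the spectral problem φ_{n+2} - (1+λ)x_{n+1}φ_{n+1} + λφ_n = 0 written
for the ratio W_n = φ_{n+1}/φ_n. Shifting `m` acts on wave functions by φ_n ↦ T_n φ_n with T_n =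
(1+λ)e_n - 2p W_n, where d = `fwd` and e = `bwd` satisfy d_{n+1} e_n = p² - q². Hence W_n
T_{n+1}/T_n solves the Riccati equation at `m + 1`. Its constant term is the new x_n, so uniqueness
identifies it with the new W_n (`omegaSeries_mul_stepSeries`).

Constant terms give the law for ln|x|, with flux ln|d_n|. After normalizing constant terms to 1, the
formal logarithm turns the product identity into the laws for all F_j, the flux being a coefficient
of the logarithm of the normalized T_n (`density_sub_density`). That the logarithm's coefficients
are the h-polynomials is the multinomial theorem (`coeff_logOf_eq_hPoly`).

The linear background gives d_n → p+q and e_n → p-q, so the fluxes have limits, equal at both ends,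
which can be subtracted. Summability of x_n - 1 passes to every ω_j and every F_j, and the
conservation laws then telescope. -/

namespace LpKdV

/-! ### The logarithm of a formal power series -/

theorem hasSubst_sub_one {f : ℝ⟦X⟧} (hf : constantCoeff f = 1) : HasSubst (f - 1) :=
  HasSubst.of_constantCoeff_zero' (by simp [hf])

theorem coeff_logOf {f : ℝ⟦X⟧} (hf : constantCoeff f = 1) (j : ℕ) :
    coeff j (logOf f) =
      ∑ k ∈ Finset.Icc 1 j, ((-1 : ℝ) ^ (k + 1) / k) * coeff j ((f - 1) ^ k) := by
  rw [logOf_eq, coeff_subst' (hasSubst_sub_one hf), finsum_eq_sum_of_support_subset]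
  · refine Finset.sum_congr rfl fun k hk => ?_
    have hk : k ≠ 0 := by
      have := (Finset.mem_Icc.1 hk).1
      omega
    simp [hk]
  · intro k hk
    rw [Function.mem_support] at hk
    rw [Finset.coe_Icc, Set.mem_Icc]
    by_contra h
    apply hk
    rcases Nat.eq_zero_or_pos k with rfl | hpos
    · simp
    -- Powers beyond `j` start above degree `j`, so the logarithmic series is a finite sum in each
    -- degree.
    · have hdvd : (X : ℝ⟦X⟧) ^ k ∣ (f - 1) ^ k :=
        pow_dvd_pow_of_dvd (X_dvd_iff.2 (by simp [hf])) k
      rw [X_pow_dvd_iff.1 hdvd j (by omega), smul_zero]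

theorem mul_derivative_logOf {f : ℝ⟦X⟧} (hf : constantCoeff f = 1) :
    f * d⁄dX ℝ (logOf f) = d⁄dX ℝ f := by
  have hs := hasSubst_sub_one hf
  have hlog : (1 + X) * d⁄dX ℝ (log ℝ) = 1 := by
    rw [deriv_log]
    ext n
    rcases n with _ | n
    · simp
    · simp [add_mul, coeff_succ_X_mul, coeff_one, pow_succ]
  have h := congrArg (subst (f - 1)) hlog
  have h1 : subst (f - 1) (1 : ℝ⟦X⟧) = 1 := by
    rw [← coe_substAlgHom hs, map_one]
  rw [subst_mul hs, subst_add hs, h1, subst_X hs, add_sub_cancel] at h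
  rw [logOf_eq, derivative_subst hs, ← mul_assoc, h]
  simp

/-- Both sides have constant term 0 and the same derivative, by additivity of logarithmic
derivatives. -/
theorem logOf_mul {f g : ℝ⟦X⟧} (hf : constantCoeff f = 1) (hg : constantCoeff g = 1) :
    logOf (f * g) = logOf f + logOf g := by
  have hfg : constantCoeff (f * g) = 1 := by simp [hf, hg]
  refine derivative.ext ?_ ?_
  · have hne : f * g ≠ 0 := fun h => by simp [h] at hfg
    refine mul_left_cancel₀ hne ?_
    rw [mul_derivative_logOf hfg, map_add]
    have h1 := mul_derivative_logOf hf
    have h2 := mul_derivative_logOf hg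
    rw [Derivation.leibniz, smul_eq_mul, smul_eq_mul]
    linear_combination -g * h1 - f * h2
  · rw [map_add, constantCoeff_logOf hfg, constantCoeff_logOf hf, constantCoeff_logOf hg, add_zero]

/-- Modulo X^(j+1), f - 1 is a polynomial, to which the multinomial theorem applies. -/
theorem coeff_pow_sub_one_eq_sum {f : ℝ⟦X⟧} (hf : constantCoeff f = 1) (j k : ℕ) :
    coeff j ((f - 1) ^ k) =
      ∑ α ∈ (Finset.piAntidiag (Finset.Icc 1 j) k).filter
          (fun α : ℕ → ℕ => ∑ i ∈ Finset.Icc 1 j, i * α i = j),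
        (Nat.multinomial (Finset.Icc 1 j) α : ℝ) * ∏ i ∈ Finset.Icc 1 j, coeff i f ^ α i := by
  set g : ℝ⟦X⟧ := ∑ i ∈ Finset.Icc 1 j, C (coeff i f) * X ^ i with hg
  have hdvd : (X : ℝ⟦X⟧) ^ (j + 1) ∣ (f - 1) ^ k - g ^ k := by
    refine dvd_trans (X_pow_dvd_iff.2 fun i hi => ?_) (sub_dvd_pow_sub_pow (f - 1) g k)
    rw [hg, map_sub, map_sub, map_sum, sub_eq_zero]
    simp only [coeff_C_mul, coeff_X_pow, mul_ite, mul_one, mul_zero, Finset.sum_ite_eq,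
      Finset.mem_Icc]
    rcases Nat.eq_zero_or_pos i with rfl | hpos
    · simp [hf]
    · rw [if_pos ⟨hpos, by omega⟩, coeff_one, if_neg hpos.ne', sub_zero]
  have hcoeff : coeff j ((f - 1) ^ k) = coeff j (g ^ k) := by
    have := X_pow_dvd_iff.1 hdvd j (Nat.lt_succ_self j)
    rwa [map_sub, sub_eq_zero] at this
  rw [hcoeff, hg, Finset.sum_pow_eq_sum_piAntidiag, map_sum, Finset.sum_filter]
  refine Finset.sum_congr rfl fun α _ => ?_
  have hprod : ∏ i ∈ Finset.Icc 1 j, (C (coeff i f) * X ^ i : ℝ⟦X⟧) ^ α i =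
      C (∏ i ∈ Finset.Icc 1 j, coeff i f ^ α i) * X ^ (∑ i ∈ Finset.Icc 1 j, i * α i) := by
    rw [map_prod, ← Finset.prod_pow_eq_pow_sum, ← Finset.prod_mul_distrib]
    refine Finset.prod_congr rfl fun i _ => ?_
    rw [mul_pow, map_pow, pow_mul]
  have hcast : (Nat.multinomial (Finset.Icc 1 j) α : ℝ⟦X⟧) =
      C (Nat.multinomial (Finset.Icc 1 j) α : ℝ) := by simp
  rw [hprod, hcast, coeff_C_mul, coeff_C_mul, coeff_X_pow]
  by_cases h : ∑ i ∈ Finset.Icc 1 j, i * α i = j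
  · rw [if_pos h, if_pos h.symm, mul_one]
  · rw [if_neg h, if_neg fun h' => h h'.symm, mul_zero, mul_zero]

theorem coeff_logOf_eq_hPoly {f : ℝ⟦X⟧} (hf : constantCoeff f = 1) (j : ℕ) :
    coeff j (logOf f) = hPoly j fun i => coeff i f := by
  rw [coeff_logOf hf, hPoly]
  refine Finset.sum_congr rfl fun k hk => ?_
  obtain ⟨k, rfl⟩ : ∃ l, k = l + 1 := ⟨k - 1, by have := (Finset.mem_Icc.1 hk).1; omega⟩
  rw [coeff_pow_sub_one_eq_sum hf, Finset.mul_sum]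
  refine Finset.sum_congr rfl fun α hα => ?_
  have hsum : ∑ i ∈ Finset.Icc 1 j, α i = k + 1 :=
    (Finset.mem_piAntidiag.1 (Finset.mem_filter.1 hα).1).1
  have hspec := Nat.multinomial_spec (Finset.Icc 1 j) α
  rw [hsum, Nat.factorial_succ] at hspec
  have hspec' : (∏ i ∈ Finset.Icc 1 j, ((α i).factorial : ℝ)) *
      Nat.multinomial (Finset.Icc 1 j) α = (k + 1) * k.factorial := by exact_mod_cast hspec
  have hne : (∏ i ∈ Finset.Icc 1 j, ((α i).factorial : ℝ)) ≠ 0 :=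
    Finset.prod_ne_zero_iff.2 fun i _ => by exact_mod_cast (α i).factorial_ne_zero
  have hk : (k : ℝ) + 1 ≠ 0 := by positivity
  rw [Nat.add_sub_cancel]
  push_cast
  field_simp
  rw [pow_add, pow_add]
  linear_combination ((-1 : ℝ) ^ k * ∏ i ∈ Finset.Icc 1 j, coeff i f ^ α i) * hspec'

/-! ### Coefficientwise limits and summability -/

section Limits

variable {ι : Type*} {l : Filter ι}

theorem tendsto_coeff_mul {f g : ι → ℝ⟦X⟧} {f₀ g₀ : ℝ⟦X⟧}
    (hf : ∀ j, Tendsto (fun n => coeff j (f n)) l (𝓝 (coeff j f₀)))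
    (hg : ∀ j, Tendsto (fun n => coeff j (g n)) l (𝓝 (coeff j g₀))) (j : ℕ) :
    Tendsto (fun n => coeff j (f n * g n)) l (𝓝 (coeff j (f₀ * g₀))) := by
  simp only [coeff_mul]
  exact tendsto_finsetSum _ fun a _ => (hf a.1).mul (hg a.2)

theorem tendsto_coeff_pow {f : ι → ℝ⟦X⟧} {f₀ : ℝ⟦X⟧}
    (hf : ∀ j, Tendsto (fun n => coeff j (f n)) l (𝓝 (coeff j f₀))) (k j : ℕ) :
    Tendsto (fun n => coeff j (f n ^ k)) l (𝓝 (coeff j (f₀ ^ k))) := by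
  induction k generalizing j with
  | zero => simpa using tendsto_const_nhds
  | succ k ih => simpa only [pow_succ] using tendsto_coeff_mul ih hf j

theorem tendsto_coeff_logOf {f : ι → ℝ⟦X⟧} {f₀ : ℝ⟦X⟧} (h1 : ∀ n, constantCoeff (f n) = 1)
    (h0 : constantCoeff f₀ = 1)
    (hf : ∀ j, Tendsto (fun n => coeff j (f n)) l (𝓝 (coeff j f₀))) (j : ℕ) :
    Tendsto (fun n => coeff j (logOf (f n))) l (𝓝 (coeff j (logOf f₀))) := by
  simp only [coeff_logOf (h1 _), coeff_logOf h0]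
  refine tendsto_finsetSum _ fun k _ => (tendsto_coeff_pow (fun i => ?_) k j).const_mul _
  simpa only [map_sub] using (hf i).sub_const _

theorem summable_mul_of_tendsto {f g : ι → ℝ} {c : ℝ} (hf : Summable f)
    (hg : Tendsto g cofinite (𝓝 c)) : Summable fun n => f n * g n := by
  refine summable_of_isBigO hf ?_
  simpa using (Asymptotics.isBigO_refl f cofinite).mul (hg.isBigO_one ℝ)

/-- The exponent starts at 1, since the zeroth power is constantly 1 and not summable over
infinitely many sites. -/
theorem summable_coeff_pow {f : ι → ℝ⟦X⟧} (hf : ∀ j, Summable fun n => coeff j (f n))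
    (k j : ℕ) : Summable fun n => coeff j (f n ^ (k + 1)) := by
  induction k generalizing j with
  | zero => simpa using hf j
  | succ k ih =>
    simp only [pow_succ _ (k + 1), coeff_mul]
    exact summable_sum fun a _ => summable_mul_of_tendsto (ih a.1) (hf a.2).tendsto_cofinite_zero

theorem summable_coeff_logOf {f : ι → ℝ⟦X⟧} (h1 : ∀ n, constantCoeff (f n) = 1)
    (hf : ∀ j, 1 ≤ j → Summable fun n => coeff j (f n)) (j : ℕ) :
    Summable fun n => coeff j (logOf (f n)) := by
  simp only [coeff_logOf (h1 _)]
  refine summable_sum fun k hk => Summable.mul_left _ ?_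
  obtain ⟨k, rfl⟩ : ∃ l, k = l + 1 := ⟨k - 1, by have := (Finset.mem_Icc.1 hk).1; omega⟩
  refine summable_coeff_pow (fun i => ?_) k j
  rcases Nat.eq_zero_or_pos i with rfl | hi
  · simp [h1]
  · simpa [coeff_one, hi.ne'] using hf i hi

end Limits

theorem tendsto_add_cofinite (a : ℤ) : Tendsto (fun n : ℤ => n + a) cofinite cofinite :=
  (add_left_injective a).tendsto_cofinite

/-- If `g - f` is the difference of a sequence that vanishes at both ends, then `f` and `g` have
the same sum. -/
theorem hasSum_eq_of_telescope {f g J : ℤ → ℝ} {a b : ℝ} (hf : HasSum f a) (hg : HasSum g b)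
    (hJ : Tendsto J cofinite (𝓝 0)) (h : ∀ n, g n - f n = J (n + 1) - J n) : a = b := by
  have hsum : HasSum (fun n => J (n + 1) - J n) (b - a) := by
    simpa only [h] using hg.sub hf
  have hlim : Tendsto (fun N : ℕ => ∑ n ∈ Finset.Ico (-N : ℤ) N, (J (n + 1) - J n)) atTop
      (𝓝 (b - a)) := hsum.comp Finset.tendsto_Ico_neg
  have htel : ∀ N : ℕ, ∑ n ∈ Finset.Ico (-N : ℤ) N, (J (n + 1) - J n) = J N - J (-N) := by
    intro N
    rw [← neg_sub (J (-N)), ← Finset.sum_Ico_int_sub, ← Finset.sum_neg_distrib]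
    simp only [neg_sub]
  simp only [htel] at hlim
  have hJ' := hJ
  rw [Int.cofinite_eq, tendsto_sup] at hJ'
  have h0 : Tendsto (fun N : ℕ => J N - J (-N)) atTop (𝓝 (0 - 0)) :=
    (hJ'.2.comp tendsto_natCast_atTop_atTop).sub
      (hJ'.1.comp (tendsto_neg_atTop_atBot.comp tendsto_natCast_atTop_atTop))
  have := tendsto_nhds_unique hlim h0
  linarith

/-! ### The Riccati equation -/

/-- The normalized power series `1 + ∑_{j ≥ 1} ω_j λ ^ j` at the site `n`. -/
noncomputable def unitSeries (x : ℤ → ℝ) (n : ℤ) : ℝ⟦X⟧ :=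
  PowerSeries.mk fun j => omegaCoeff x j n

theorem omegaSeries_eq (x : ℤ → ℝ) (n : ℤ) : omegaSeries x n = C (x n) * unitSeries x n := rfl

@[simp]
theorem coeff_unitSeries (x : ℤ → ℝ) (n : ℤ) (j : ℕ) :
    coeff j (unitSeries x n) = omegaCoeff x j n := coeff_mk _ _

@[simp]
theorem constantCoeff_unitSeries (x : ℤ → ℝ) (n : ℤ) : constantCoeff (unitSeries x n) = 1 := by
  rw [← coeff_zero_eq_constantCoeff_apply, coeff_unitSeries, omegaCoeff]

@[simp]
theorem constantCoeff_omegaSeries (x : ℤ → ℝ) (n : ℤ) :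
    constantCoeff (omegaSeries x n) = x n := by
  simp [omegaSeries_eq]

theorem omegaCoeff_succ_succ (x : ℤ → ℝ) (j : ℕ) (n : ℤ) :
    omegaCoeff x (j + 2) n = omegaCoeff x (j + 1) (n - 1) -
      ∑ a ∈ Finset.HasAntidiagonal.antidiagonal j,
        omegaCoeff x (a.1 + 1) (n - 1) * omegaCoeff x (a.2 + 1) n := by
  rw [omegaCoeff, Finset.Nat.sum_antidiagonal_eq_sum_range_succ
    (fun a b => omegaCoeff x (a + 1) (n - 1) * omegaCoeff x (b + 1) n),
    Fin.sum_univ_eq_sum_range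
      (fun k => omegaCoeff x (k + 1) (n - 1) * omegaCoeff x (j + 1 - k) n)]
  congr 1
  refine Finset.sum_congr rfl fun k hk => ?_
  rw [Nat.sub_add_comm (Nat.lt_succ_iff.1 (Finset.mem_range.1 hk))]

theorem unitSeries_riccati (x : ℤ → ℝ) (n : ℤ) :
    unitSeries x n * (unitSeries x (n + 1) - 1 - X) + X * C (1 / (x (n + 1) * x n)) = 0 := by
  set S : ℤ → ℝ⟦X⟧ := fun n => PowerSeries.mk fun j => omegaCoeff x (j + 1) n with hS
  have hunit : ∀ n, unitSeries x n = 1 + X * S n := by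
    intro n
    ext j
    rcases j with _ | j
    · simp [omegaCoeff]
    · simp [hS, coeff_succ_X_mul, coeff_one]
  -- This is the equation divided by X; its coefficients are exactly the recursion for ω_j.
  have key : S (n + 1) + X * (S n * S (n + 1)) - 1 - X * S n + C (1 / (x (n + 1) * x n)) = 0 := by
    ext j
    rcases j with _ | j
    · simp [hS, omegaCoeff]
    · simp only [map_add, map_sub, coeff_succ_X_mul]
      simp only [coeff_one, coeff_C, coeff_mul, hS, coeff_mk,
        omegaCoeff_succ_succ, add_sub_cancel_right, Nat.succ_ne_zero, if_false, map_zero]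
      ring
  rw [hunit n, hunit (n + 1)]
  linear_combination X * key

theorem isRiccatiSolution_omegaSeries {x : ℤ → ℝ} (hx : ∀ n, x n ≠ 0) :
    IsRiccatiSolution x (omegaSeries x) := by
  intro n
  have h := unitSeries_riccati x n
  have hC : (C (x n) * C (x (n + 1)) * C (1 / (x (n + 1) * x n)) : ℝ⟦X⟧) = 1 := by
    rw [← map_mul, ← map_mul, ← map_one (C (R := ℝ))]
    congr 1
    have := hx n
    have := hx (n + 1)
    field_simp
  rw [omegaSeries_eq, omegaSeries_eq]
  linear_combination C (x n) * C (x (n + 1)) * h - X * hC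

/-- Subtracting the two equations expresses the difference at n+1 through the difference at n times
a multiple of X, up to the unit W_n. The order of vanishing therefore grows by one per site, and
every site of ℤ has a predecessor. -/
theorem IsRiccatiSolution.unique {x : ℤ → ℝ} (hx : ∀ n, x n ≠ 0) {W W' : ℤ → ℝ⟦X⟧}
    (hW : IsRiccatiSolution x W) (hW' : IsRiccatiSolution x W')
    (h0 : ∀ n, constantCoeff (W n) = x n) (h0' : ∀ n, constantCoeff (W' n) = x n) : W = W' := by
  have key : ∀ (k : ℕ) (n : ℤ), (X : ℝ⟦X⟧) ^ k ∣ W n - W' n := by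
    intro k
    induction k with
    | zero => simp
    | succ k ih =>
      intro n
      obtain ⟨n, rfl⟩ : ∃ i, n = i + 1 := ⟨n - 1, by ring⟩
      have hunit : IsUnit (W n) := by
        rw [isUnit_iff_constantCoeff, h0]
        exact (hx n).isUnit
      have hX : (X : ℝ⟦X⟧) ∣ W' (n + 1) - C (x (n + 1)) - X * C (x (n + 1)) :=
        X_dvd_iff.2 (by simp [h0'])
      have h : W n * (W (n + 1) - W' (n + 1)) =
          -((W n - W' n) * (W' (n + 1) - C (x (n + 1)) - X * C (x (n + 1)))) := by
        linear_combination hW n - hW' n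
      refine (hunit.dvd_mul_left).1 ?_
      rw [h, pow_succ]
      exact (mul_dvd_mul (ih n) hX).neg_right
  funext n
  rw [← sub_eq_zero]
  ext j
  exact X_pow_dvd_iff.1 (key (j + 1) n) j (Nat.lt_succ_self j)

theorem isRiccatiSolution_iff {x : ℤ → ℝ} (hx : ∀ n, x n ≠ 0) (W : ℤ → ℝ⟦X⟧) :
    (IsRiccatiSolution x W ∧ ∀ n, constantCoeff (W n) = x n) ↔ W = omegaSeries x := by
  constructor
  · rintro ⟨hW, h0⟩
    exact hW.unique hx (isRiccatiSolution_omegaSeries hx) h0 (constantCoeff_omegaSeries x)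
  · rintro rfl
    exact ⟨isRiccatiSolution_omegaSeries hx, constantCoeff_omegaSeries x⟩

theorem summable_omegaCoeff {x : ℤ → ℝ} (hx : Summable fun n => x n - 1) (j : ℕ) :
    Summable (omegaCoeff x (j + 1)) := by
  have hlim : Tendsto x cofinite (𝓝 1) := by
    simpa using hx.tendsto_cofinite_zero.add_const 1
  have hshift : ∀ f : ℤ → ℝ, Summable f → Summable fun n => f (n - 1) := fun f hf =>
    hf.comp_injective (sub_left_injective (b := (1 : ℤ)))
  have hlim' : Tendsto (fun n => x (n - 1)) cofinite (𝓝 1) :=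
    hlim.comp (tendsto_add_cofinite (-1))
  induction j using Nat.strong_induction_on with
  | _ j ih =>
    rcases j with _ | j
    · have hinv : Tendsto (fun n => (x n * x (n - 1))⁻¹) cofinite (𝓝 (1 * 1)⁻¹) :=
        (hlim.mul hlim').inv₀ (by norm_num)
      -- The numerator of ω_1 is x_n x_{n-1} - 1 = (x_n - 1)x_{n-1} + (x_{n-1} - 1). Zeros of x, not
      -- excluded here, are finitely many.
      have hnum := (summable_mul_of_tendsto hx hlim').add (hshift _ hx)
      refine (summable_mul_of_tendsto hnum hinv).congr_cofinite ?_
      filter_upwards [hlim.eventually_ne one_ne_zero, hlim'.eventually_ne one_ne_zero] with n h1 h2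
      rw [omegaCoeff]
      field_simp
      ring
    · have hrec := (hshift _ (ih j (Nat.lt_succ_self j))).sub
        (summable_sum (s := Finset.HasAntidiagonal.antidiagonal j)
          (f := fun a n => omegaCoeff x (a.1 + 1) (n - 1) * omegaCoeff x (a.2 + 1) n)
          fun a ha => summable_mul_of_tendsto
            (hshift _ (ih a.1 (by have := Finset.HasAntidiagonal.mem_antidiagonal.1 ha; omega)))
            (ih a.2 (by have := Finset.HasAntidiagonal.mem_antidiagonal.1 ha; omega)
              ).tendsto_cofinite_zero)
      exact hrec.congr fun n => (omegaCoeff_succ_succ x j n).symm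

/-! ### The Darboux step in the direction `m` -/

/-- `d_n = u_{n,m+1} - u_{n-1,m}`. -/
def fwd (u : ℤ → ℤ → ℝ) (n m : ℤ) : ℝ := u n (m + 1) - u (n - 1) m

/-- `e_n = u_{n+1,m} - u_{n,m+1}`. -/
def bwd (u : ℤ → ℤ → ℝ) (n m : ℤ) : ℝ := u (n + 1) m - u n (m + 1)

section Step

variable {p q : ℝ} {u : ℤ → ℤ → ℝ}

theorem IsSolution.fwd_mul_bwd (hu : IsSolution p q u) (n m : ℤ) :
    fwd u (n + 1) m * bwd u n m = p ^ 2 - q ^ 2 := by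
  simpa [fwd, bwd] using hu n m

theorem two_mul_xField (hp : p ≠ 0) (n m : ℤ) :
    2 * p * xField p u n m = bwd u n m + fwd u n m := by
  simp only [xField, fwd, bwd]
  field_simp
  ring

theorem two_mul_xField_succ (hp : p ≠ 0) (n m : ℤ) :
    2 * p * xField p u n (m + 1) = bwd u (n - 1) m + fwd u (n + 1) m := by
  simp only [xField, fwd, bwd, sub_add_cancel, add_sub_cancel_right]
  field_simp
  ring

/-- The constants at the two ends may differ, but at each end the constant cancels because it does
not depend on `m`. -/
theorem HasLinearBackground.tendsto_sub (hbg : HasLinearBackground p q u) (a b m m' : ℤ) :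
    Tendsto (fun n => u (n + a) m - u (n + b) m') cofinite
      (𝓝 (p * (a - b) + q * (m - m'))) := by
  obtain ⟨c, c', h⟩ := hbg
  have aux : ∀ {l : Filter ℤ} {c : ℝ}, (∀ a : ℤ, Tendsto (fun n : ℤ => n + a) l l) →
      (∀ m : ℤ, Tendsto (fun n : ℤ => u n m - (p * n + q * m)) l (𝓝 c)) →
      Tendsto (fun n => u (n + a) m - u (n + b) m') l (𝓝 (p * (a - b) + q * (m - m'))) := by
    intro l c hl hc
    have := (((hc m).comp (hl a)).sub ((hc m').comp (hl b))).add_const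
      (p * (a - b) + q * (m - m'))
    rw [sub_self, zero_add] at this
    refine this.congr fun n => ?_
    simp only [Function.comp]
    push_cast
    ring
  rw [Int.cofinite_eq]
  exact (aux (fun a => tendsto_atBot_add_const_right _ a tendsto_id) fun m => (h m).1).sup
    (aux (fun a => tendsto_atTop_add_const_right _ a tendsto_id) fun m => (h m).2)

theorem HasLinearBackground.tendsto_fwd (hbg : HasLinearBackground p q u) (m : ℤ) :
    Tendsto (fun n => fwd u n m) cofinite (𝓝 (p + q)) := by
  have h := hbg.tendsto_sub 0 (-1) (m + 1) m
  simpa [fwd, sub_eq_add_neg] using h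

theorem HasLinearBackground.tendsto_bwd (hbg : HasLinearBackground p q u) (m : ℤ) :
    Tendsto (fun n => bwd u n m) cofinite (𝓝 (p - q)) := by
  have h := hbg.tendsto_sub 1 0 m (m + 1)
  simpa [bwd, sub_eq_add_neg] using h

/-- A zero of d forces p² = q². Then x ≠ 0 gives e ≠ 0 at that site, so d vanishes at the next site
too, and so on up to +∞, against the limit p + q > 0. -/
theorem fwd_ne_zero (hp : 0 < p) (hq : 0 < q) (hu : IsSolution p q u)
    (hbg : HasLinearBackground p q u) (hx : ∀ n m, xField p u n m ≠ 0) (n m : ℤ) :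
    fwd u n m ≠ 0 := by
  intro h0
  have hP : p ^ 2 - q ^ 2 = 0 := by
    have := hu.fwd_mul_bwd (n - 1) m
    rw [sub_add_cancel, h0, zero_mul] at this
    exact this.symm
  have hall : ∀ k, n ≤ k → fwd u k m = 0 := by
    intro k hk
    induction k, hk using Int.leInduction with
    | base => exact h0
    | succ k _ ih =>
      have hb : bwd u k m ≠ 0 := by
        have h2 := two_mul_xField (u := u) hp.ne' k m
        rw [ih, add_zero] at h2
        rw [← h2]
        exact mul_ne_zero (by positivity) (hx k m)
      have := hu.fwd_mul_bwd k m
      rw [hP] at this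
      exact (mul_eq_zero.1 this).resolve_right hb
  have hlim : Tendsto (fun n => fwd u n m) atTop (𝓝 (p + q)) :=
    (hbg.tendsto_fwd m).mono_left (by rw [Int.cofinite_eq]; exact le_sup_right)
  have h0lim : Tendsto (fun n => fwd u n m) atTop (𝓝 0) :=
    tendsto_const_nhds.congr' ((eventually_ge_atTop n).mono fun k hk => (hall k hk).symm)
  have := tendsto_nhds_unique hlim h0lim
  linarith

/-- The ratio of a wave function and its shift in the direction `m`, up to a constant factor. -/
noncomputable def stepSeries (p : ℝ) (u : ℤ → ℤ → ℝ) (n m : ℤ) : ℝ⟦X⟧ :=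
  (1 + X) * C (bwd u n m) - C (2 * p) * omegaSeries (fun k => xField p u k m) n

theorem constantCoeff_stepSeries (hp : p ≠ 0) (n m : ℤ) :
    constantCoeff (stepSeries p u n m) = -fwd u n m := by
  have h := two_mul_xField (u := u) hp n m
  simp only [stepSeries, map_sub, map_mul, map_add, map_one, constantCoeff_X, constantCoeff_C,
    constantCoeff_omegaSeries]
  linear_combination -h

theorem omegaSeries_mul_stepSeries (hp : p ≠ 0) (hu : IsSolution p q u)
    (hx : ∀ n m, xField p u n m ≠ 0) (hd : ∀ n m, fwd u n m ≠ 0) (n m : ℤ) :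
    omegaSeries (fun k => xField p u k (m + 1)) n * stepSeries p u n m =
      omegaSeries (fun k => xField p u k m) n * stepSeries p u (n + 1) m := by
  set W := omegaSeries (fun k => xField p u k m) with hW
  set T := fun n => stepSeries p u n m with hT
  have hT0 : ∀ n, constantCoeff (T n) ≠ 0 := fun n => by
    rw [hT, constantCoeff_stepSeries hp]
    exact neg_ne_zero.2 (hd n m)
  have hTne : ∀ n, T n ≠ 0 := fun n h => hT0 n (by rw [h, map_zero])
  have hTinv : ∀ n, (T n)⁻¹ * T n = 1 := fun n => PowerSeries.inv_mul_cancel _ (hT0 n)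
  set V : ℤ → ℝ⟦X⟧ := fun n => W n * T (n + 1) * (T n)⁻¹ with hV
  have hVT : ∀ n, V n * T n = W n * T (n + 1) := fun n => by
    rw [hV]
    linear_combination W n * T (n + 1) * hTinv n
  have hric : IsRiccatiSolution (fun k => xField p u k (m + 1)) V := by
    intro n
    have r1 := isRiccatiSolution_omegaSeries (fun k => hx k m) n
    have r2 := isRiccatiSolution_omegaSeries (fun k => hx k m) (n + 1)
    have hTn : ∀ n, T n = (1 + X) * C (bwd u n m) - C (2 * p) * W n := fun n => rfl
    have c1 : (C (2 * p) * C (xField p u (n + 1) m) : ℝ⟦X⟧) =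
        C (bwd u (n + 1) m) + C (fwd u (n + 1) m) := by
      rw [← map_mul, ← map_add, two_mul_xField hp]
    have c2 : (C (2 * p) * C (xField p u (n + 1 + 1) m) : ℝ⟦X⟧) =
        C (bwd u (n + 1 + 1) m) + C (fwd u (n + 1 + 1) m) := by
      rw [← map_mul, ← map_add, two_mul_xField hp]
    have c3 : (C (2 * p) * C (xField p u (n + 1) (m + 1)) : ℝ⟦X⟧) =
        C (bwd u n m) + C (fwd u (n + 1 + 1) m) := by
      rw [← map_mul, ← map_add, two_mul_xField_succ hp, add_sub_cancel_right]
    -- Both sides times 2p equal e_n e_{n+1} + p² - q², by the lattice equation at n and n+1.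
    have c4 : (C (bwd u n m) * C (xField p u (n + 1) m) : ℝ⟦X⟧) =
        C (bwd u (n + 1) m) * C (xField p u (n + 1) (m + 1)) := by
      rw [← map_mul, ← map_mul]
      congr 1
      have h1 := two_mul_xField (u := u) hp (n + 1) m
      have h2 := two_mul_xField_succ (u := u) hp (n + 1) m
      rw [add_sub_cancel_right] at h2
      have h3 := hu.fwd_mul_bwd n m
      have h4 := hu.fwd_mul_bwd (n + 1) m
      refine mul_left_cancel₀ (mul_ne_zero two_ne_zero hp) ?_
      linear_combination bwd u n m * h1 - bwd u (n + 1) m * h2 + h3 - h4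
    rw [← hW] at r1 r2
    refine mul_left_cancel₀ (mul_ne_zero (hTne n) (hTne (n + 1))) ?_
    -- The Riccati equation removes the product W_n W_{n+1}, leaving an expression affine in W_n.
    have hstep : W n * T (n + 1) = -(1 + X) * C (fwd u (n + 1) m) * W n + C (2 * p) * X := by
      rw [hTn]
      linear_combination -C (2 * p) * r1 - (1 + X) * W n * c1
    have hstep' : W (n + 1) * T (n + 1 + 1) =
        -(1 + X) * C (fwd u (n + 1 + 1) m) * W (n + 1) + C (2 * p) * X := by
      rw [hTn]
      linear_combination -C (2 * p) * r2 - (1 + X) * W (n + 1) * c2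
    -- Multiplied by T_{n+1}, this is the Riccati equation for V with the denominators T_n and
    -- T_{n+1} cleared.
    have main : W n * (W (n + 1) * T (n + 1 + 1) -
        (1 + X) * C (xField p u (n + 1) (m + 1)) * T (n + 1)) + X * T n = 0 := by
      rw [hstep', hTn, hTn]
      linear_combination (1 + X) * C (bwd u n m) * r1 + (1 + X) * W n * W (n + 1) * c3 +
        (1 + X) ^ 2 * W n * c4
    have hV1 := hVT n
    have hV2 := hVT (n + 1)
    linear_combination T (n + 1) * main +
      T (n + 1) * (V (n + 1) - (1 + X) * C (xField p u (n + 1) (m + 1))) * hV1 +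
      W n * T (n + 1) * hV2
  have hV0 : ∀ n, constantCoeff (V n) = xField p u n (m + 1) := by
    intro n
    have h := congrArg constantCoeff (hVT n)
    rw [map_mul _ (V n), map_mul _ (W n), show constantCoeff (T n) = -fwd u n m from
      constantCoeff_stepSeries hp n m, show constantCoeff (T (n + 1)) = -fwd u (n + 1) m from
      constantCoeff_stepSeries hp (n + 1) m, hW,
      constantCoeff_omegaSeries] at h
    have h1 := two_mul_xField (u := u) hp n m
    have h2 := two_mul_xField_succ (u := u) hp n m
    have h3 := hu.fwd_mul_bwd n m
    have h4 := hu.fwd_mul_bwd (n - 1) m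
    rw [sub_add_cancel] at h4
    refine mul_left_cancel₀ (mul_ne_zero (mul_ne_zero two_ne_zero hp) (hd n m)) ?_
    -- Both 2p x_n d_{n+1} and its counterpart 2p x_n(m+1) d_n equal d_n d_{n+1} + p² - q².
    linear_combination -2 * p * h + fwd u (n + 1) m * h1 - fwd u n m * h2 + h3 - h4
  have huniq := (isRiccatiSolution_iff (fun n => hx n (m + 1)) V).1 ⟨hric, hV0⟩
  rw [← huniq]
  exact hVT n

end Step

/-! ### Densities and fluxes -/

section Densities

variable {p q : ℝ} {u : ℤ → ℤ → ℝ}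

theorem density_of_pos {j : ℕ} (hj : 1 ≤ j) (n m : ℤ) :
    density p u j n m = coeff j (logOf (unitSeries (fun k => xField p u k m) n)) := by
  rw [density, if_neg (by omega), coeff_logOf_eq_hPoly (constantCoeff_unitSeries _ _)]
  simp only [coeff_unitSeries]

theorem logOf_unitSeries (n m : ℤ) :
    logOf (unitSeries (fun k => xField p u k m) n) =
      PowerSeries.mk fun j => if j = 0 then 0 else density p u j n m := by
  ext j
  rw [coeff_mk]
  split_ifs with hj
  · rw [hj, coeff_zero_eq_constantCoeff_apply, constantCoeff_logOf (constantCoeff_unitSeries _ _)]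
  · rw [density_of_pos (Nat.one_le_iff_ne_zero.2 hj)]

theorem MemP.summable_xField_sub_one (hp : p ≠ 0) {m : ℤ}
    (hs : MemP p 0 fun n => potential u n m) : Summable fun n => xField p u n m - 1 := by
  have h : Summable fun n => potential u n m - 2 * p := by
    simpa only [MemP, pow_zero, one_mul, summable_abs_iff] using hs
  have h' := (h.comp_injective (sub_left_injective (b := (1 : ℤ)))).div_const (2 * p)
  refine h'.congr fun n => ?_
  simp only [Function.comp, potential, xField]
  rw [show n - 1 + 2 = n + 1 by ring]
  field_simp

theorem summable_density (hp : p ≠ 0) {m : ℤ} (hs : MemP p 0 fun n => potential u n m) (j : ℕ) :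
    Summable fun n => density p u j n m := by
  have hx := hs.summable_xField_sub_one hp
  rcases Nat.eq_zero_or_pos j with rfl | hj
  · simpa [density] using Real.summable_log_one_add_of_summable hx
  · simp only [density_of_pos hj]
    refine summable_coeff_logOf (fun n => constantCoeff_unitSeries _ n) (fun i hi => ?_) j
    obtain ⟨i, rfl⟩ : ∃ l, i = l + 1 := ⟨i - 1, by omega⟩
    simpa only [coeff_unitSeries] using summable_omegaCoeff hx i

/-- The series `stepSeries`, divided by its constant term. -/
noncomputable def unitStepSeries (p : ℝ) (u : ℤ → ℤ → ℝ) (n m : ℤ) : ℝ⟦X⟧ :=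
  C (-1 / fwd u n m) * stepSeries p u n m

/-- The limit of `unitStepSeries` as `|n| → ∞`. -/
noncomputable def unitStepLimit (p q : ℝ) : ℝ⟦X⟧ :=
  C (-1 / (p + q)) * ((1 + X) * C (p - q) - C (2 * p) * (C 1 * 1))

theorem constantCoeff_unitStepSeries (hp : p ≠ 0) {n m : ℤ} (hd : fwd u n m ≠ 0) :
    constantCoeff (unitStepSeries p u n m) = 1 := by
  rw [unitStepSeries, map_mul, constantCoeff_C, constantCoeff_stepSeries hp]
  field_simp

theorem constantCoeff_unitStepLimit (hpq : p + q ≠ 0) :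
    constantCoeff (unitStepLimit p q) = 1 := by
  simp only [unitStepLimit, map_sub, map_mul, map_add, map_one, constantCoeff_X, constantCoeff_C]
  field_simp
  ring

theorem tendsto_coeff_C {ι : Type*} {l : Filter ι} {a : ι → ℝ} {a₀ : ℝ}
    (h : Tendsto a l (𝓝 a₀)) (j : ℕ) :
    Tendsto (fun n => coeff j (C (a n) : ℝ⟦X⟧)) l (𝓝 (coeff j (C a₀ : ℝ⟦X⟧))) := by
  simp only [coeff_C]
  split_ifs
  · exact h
  · exact tendsto_const_nhds

theorem tendsto_coeff_unitStepSeries (hp : p ≠ 0) (hpq : p + q ≠ 0)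
    (hbg : HasLinearBackground p q u) {m : ℤ} (hs : MemP p 0 fun n => potential u n m) (j : ℕ) :
    Tendsto (fun n => coeff j (unitStepSeries p u n m)) cofinite
      (𝓝 (coeff j (unitStepLimit p q))) := by
  have hx := hs.summable_xField_sub_one hp
  have hxlim : Tendsto (fun n => xField p u n m) cofinite (𝓝 1) := by
    simpa using hx.tendsto_cofinite_zero.add_const 1
  have hunit : ∀ j, Tendsto (fun n => coeff j (unitSeries (fun k => xField p u k m) n)) cofinite
      (𝓝 (coeff j (1 : ℝ⟦X⟧))) := by
    intro j
    simp only [coeff_unitSeries]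
    rcases j with _ | j
    · simp [omegaCoeff]
    · simpa [coeff_one] using (summable_omegaCoeff hx j).tendsto_cofinite_zero
  have homega : ∀ j, Tendsto (fun n => coeff j (omegaSeries (fun k => xField p u k m) n)) cofinite
      (𝓝 (coeff j (C 1 * 1 : ℝ⟦X⟧))) := by
    simp only [omegaSeries_eq]
    exact tendsto_coeff_mul (tendsto_coeff_C hxlim) hunit
  have hd : Tendsto (fun n => -1 / fwd u n m) cofinite (𝓝 (-1 / (p + q))) :=
    tendsto_const_nhds.div (hbg.tendsto_fwd m) hpq
  have hstep : ∀ j, Tendsto (fun n => coeff j (stepSeries p u n m)) cofinite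
      (𝓝 (coeff j ((1 + X) * C (p - q) - C (2 * p) * (C 1 * 1) : ℝ⟦X⟧))) := by
    intro j
    simp only [stepSeries, map_sub (coeff (R := ℝ) j)]
    exact (tendsto_coeff_mul (fun _ => tendsto_const_nhds)
      (tendsto_coeff_C (hbg.tendsto_bwd m)) j).sub
        (tendsto_coeff_mul (fun _ => tendsto_const_nhds) homega j)
  exact tendsto_coeff_mul (tendsto_coeff_C hd) hstep j

theorem xField_mul_fwd (hp : p ≠ 0) (hu : IsSolution p q u) (hx : ∀ n m, xField p u n m ≠ 0)
    (hd : ∀ n m, fwd u n m ≠ 0) (n m : ℤ) :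
    xField p u n (m + 1) * fwd u n m = xField p u n m * fwd u (n + 1) m := by
  have h := congrArg constantCoeff (omegaSeries_mul_stepSeries hp hu hx hd n m)
  simpa [constantCoeff_stepSeries hp] using h

theorem unitSeries_mul_unitStepSeries (hp : p ≠ 0) (hu : IsSolution p q u)
    (hx : ∀ n m, xField p u n m ≠ 0) (hd : ∀ n m, fwd u n m ≠ 0) (n m : ℤ) :
    unitSeries (fun k => xField p u k (m + 1)) n * unitStepSeries p u n m =
      unitSeries (fun k => xField p u k m) n * unitStepSeries p u (n + 1) m := by
  have hstep : ∀ n, stepSeries p u n m = C (-fwd u n m) * unitStepSeries p u n m := by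
    intro n
    have := hd n m
    rw [unitStepSeries, ← mul_assoc, ← map_mul, show -fwd u n m * (-1 / fwd u n m) = 1 by
      field_simp, map_one, one_mul]
  have h := omegaSeries_mul_stepSeries hp hu hx hd n m
  rw [omegaSeries_eq, omegaSeries_eq, hstep, hstep, map_neg, map_neg] at h
  have hc : (C (xField p u n (m + 1)) * C (fwd u n m) : ℝ⟦X⟧) =
      C (xField p u n m) * C (fwd u (n + 1) m) := by
    rw [← map_mul, ← map_mul, xField_mul_fwd hp hu hx hd]
  -- The constant terms of the two sides agree by `xField_mul_fwd`, so this common factor cancels.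
  have hne : (C (xField p u n m) * C (fwd u (n + 1) m) : ℝ⟦X⟧) ≠ 0 := by
    rw [← map_mul, Ne, map_eq_zero_iff _ C_injective]
    exact mul_ne_zero (hx n m) (hd (n + 1) m)
  refine mul_left_cancel₀ hne ?_
  linear_combination -h - unitSeries (fun k => xField p u k (m + 1)) n *
    unitStepSeries p u n m * hc

/-- The flux of `density p u j`, normalized so that it vanishes as `|n| → ∞`. -/
noncomputable def flux (p q : ℝ) (u : ℤ → ℤ → ℝ) (j : ℕ) (n m : ℤ) : ℝ :=
  if j = 0 then Real.log (fwd u n m) - Real.log (p + q)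
  else coeff j (logOf (unitStepSeries p u n m)) - coeff j (logOf (unitStepLimit p q))

theorem density_sub_density (hp : p ≠ 0) (hu : IsSolution p q u)
    (hx : ∀ n m, xField p u n m ≠ 0) (hd : ∀ n m, fwd u n m ≠ 0) (j : ℕ) (n m : ℤ) :
    density p u j n (m + 1) - density p u j n m =
      flux p q u j (n + 1) m - flux p q u j n m := by
  rcases Nat.eq_zero_or_pos j with rfl | hj
  · have h := congrArg Real.log (xField_mul_fwd hp hu hx hd n m)
    -- `Real.log` is ln|·|, so nonvanishing is enough and signs play no role.
    rw [Real.log_mul (hx _ _) (hd _ _), Real.log_mul (hx _ _) (hd _ _)] at h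
    simp only [density, flux, if_true]
    linear_combination h
  · have h := congrArg (fun f => coeff j (logOf f)) (unitSeries_mul_unitStepSeries hp hu hx hd n m)
    simp only [logOf_mul (constantCoeff_unitSeries _ _)
      (constantCoeff_unitStepSeries hp (hd _ _)), map_add] at h
    rw [density_of_pos hj, density_of_pos hj, flux, flux, if_neg hj.ne', if_neg hj.ne']
    linear_combination h

theorem tendsto_flux (hp : p ≠ 0) (hpq : p + q ≠ 0) (hbg : HasLinearBackground p q u)
    (hd : ∀ n m, fwd u n m ≠ 0) {m : ℤ} (hs : MemP p 0 fun n => potential u n m) (j : ℕ) :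
    Tendsto (fun n => flux p q u j n m) cofinite (𝓝 0) := by
  rcases Nat.eq_zero_or_pos j with rfl | hj
  · simpa [flux] using ((hbg.tendsto_fwd m).log hpq).sub_const (Real.log (p + q))
  · simp only [flux, if_neg hj.ne']
    rw [← sub_self (coeff j (logOf (unitStepLimit p q)))]
    exact (tendsto_coeff_logOf (fun n => constantCoeff_unitStepSeries hp (hd n m))
      (constantCoeff_unitStepLimit hpq) (tendsto_coeff_unitStepSeries hp hpq hbg hs) j).sub_const _

end Densities

end LpKdV
theorem proposition2 (p q : ℝ) (hp : 0 < p) (hq : 0 < q) (u : ℤ → ℤ → ℝ)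
    (hu : LpKdV.IsSolution p q u)
    (hbg : LpKdV.HasLinearBackground p q u)
    (hs : ∀ m : ℤ, LpKdV.MemP p 0 (fun n => LpKdV.potential u n m))
    (hx : ∀ n m : ℤ, LpKdV.xField p u n m ≠ 0) :
    -- the `ω_j` are the coefficients of the solution of the Riccati equation with leading term `x`
    (∀ (m : ℤ) (W : ℤ → ℝ⟦X⟧),
      (LpKdV.IsRiccatiSolution (fun k => LpKdV.xField p u k m) W ∧
        ∀ n : ℤ, PowerSeries.constantCoeff (W n) = LpKdV.xField p u n m) ↔
      W = LpKdV.omegaSeries (fun k => LpKdV.xField p u k m)) ∧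
    -- the densities `F_j = h_j(ω)`, `j ≥ 1`, are the coefficients of `ln (1 + ∑ ω_i λ ^ i)`
    (∀ n m : ℤ,
      PowerSeries.logOf
          (PowerSeries.mk fun i => LpKdV.omegaCoeff (fun k => LpKdV.xField p u k m) i n) =
        PowerSeries.mk fun j => if j = 0 then 0 else LpKdV.density p u j n m) ∧
    -- every `F_j`, `j ≥ 0`, is a conserved density
    (∀ j : ℕ, LpKdV.IsConservedDensity (LpKdV.density p u j)) ∧
    -- the sums `H_j = ∑_n F_j` converge absolutely and do not depend on `m`
    (∃ H : ℕ → ℝ, ∀ (j : ℕ) (m : ℤ), HasSum (fun n : ℤ => LpKdV.density p u j n m) (H j)) := by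
  have hp' := hp.ne'
  have hpq : p + q ≠ 0 := (add_pos hp hq).ne'
  have hd := LpKdV.fwd_ne_zero hp hq hu hbg hx
  have hsum := fun j m => LpKdV.summable_density hp' (hs m) j
  refine ⟨fun m W => LpKdV.isRiccatiSolution_iff (fun n => hx n m) W,
    fun n m => LpKdV.logOf_unitSeries n m,
    fun j => ⟨fun m => (hsum j m).tendsto_cofinite_zero, LpKdV.flux p q u j,
      LpKdV.density_sub_density hp' hu hx hd j,
      fun m => LpKdV.tendsto_flux hp' hpq hbg hd (hs m) j⟩,
    fun j => ∑' n, LpKdV.density p u j n 0, fun j m => ?_⟩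
  beta_reduce
  -- Summing the conservation law over n leaves only boundary fluxes, which tend to 0.
  have hstep : ∀ m, ∑' n, LpKdV.density p u j n (m + 1) = ∑' n, LpKdV.density p u j n m :=
    fun m => (LpKdV.hasSum_eq_of_telescope (hsum j m).hasSum (hsum j (m + 1)).hasSum
      (LpKdV.tendsto_flux hp' hpq hbg hd (hs m) j)
      fun n => LpKdV.density_sub_density hp' hu hx hd j n m).symm
  have hconst : ∑' n, LpKdV.density p u j n m = ∑' n, LpKdV.density p u j n 0 := by
    induction m with
    | zero => rfl
    | succ k ih => rw [hstep, ih]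
    | pred k ih => rw [← hstep, sub_add_cancel, ih]
  rw [← hconst]
  exact (hsum j m).hasSum
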